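/- Let $\alpha>0$. For a subset $\mathbb{D}$ of a real Hilbert space $H$ let $B_1(\mathbb{D})$ be the closure of the set of all finite sums $\sum_{j=1}^m a_jh_j$ with $m\ge 0$, $h_j\in\mathbb{D}$, $a_j\in\mathbb{R}$ and $\sum_j|a_j|\le 1$; for $A\subset H$ let $\epsilon_n(A)$ be the infimum of all $\epsilon\ge 0$ such that $A$ can be covered by $2^n$ balls of radius $\epsilon$ in $H$. The orthogonal greedy algorithm applied to $f\in H$ starts with $f_0=0$ and, for $k\ge1$, chooses $g_k\in\mathbb{D}$ maximizing $|\langle g,f-f_{k-1}\rangle|$ over $g\in\mathbb{D}$ (ties are broken arbitrarily) and lets $f_k$ be the orthogonal projection of $f$ onto $\mathrm{span}(g_1,\dots,g_k)$. Let $H=\ell^2$ be the real sequence space with standard basis $e_1,e_2,\dots$, and let $\mathbb{D}=\{k^{-\alpha}e_k : k\ge 1\}$. Then $\|g\|\le 1$ for all $g\in\mathbb{D}$, the maxima in the orthogonal greedy algorithm are attained, so that the algorithm can be run on every $f\in\ell^2$, and there are constants $C,K>0$ depending only on $\alpha$ such that for all $n\ge1$ $$\epsilon_n(B_1(\mathbb{D}))\le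 C\,n^{-\frac12-\alpha}$$ and, however the ties are broken for each $f$, $$\sup_{f\in B_1(\mathbb{D})}\|f-f_n\|\ge K\,n^{-\frac12-\alpha},$$ where $f_n$ is the $n$-th iterate of the orthogonal greedy algorithm applied to $f$. Consequently the rate $n^{-\frac12-\alpha}$, which the orthogonal greedy algorithm is known to achieve uniformly on $B_1(\mathbb{D})$ under this entropy bound, cannot be improved: there is no sequence $\rho_n=o(n^{-\frac12-\alpha})$ such that, for all sufficiently large $n$, $\|f-f_n\|\le\rho_n$ holds for all $f\in B_1(\mathbb{D})$ and all choices of the algorithm. -/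

import Mathlib

open Filter Topology
open scoped NNReal ENNReal

noncomputable section

namespace GreedySharpness

/-- The (dyadic) metric entropy `ε_n(A)`: the infimum of all radii `ε` such that `A` can be covered
by `2 ^ n` balls of radius `ε` with centers in `X`. The value is extended, and equals `∞` if there
is no such radius. -/
def metricEntropy {X : Type*} [PseudoMetricSpace X] (n : ℕ) (A : Set X) : ℝ≥0∞ :=
  ⨅ (ε : ℝ≥0) (_ : Metric.externalCoveringNumber ε A ≤ 2 ^ n), (ε : ℝ≥0∞)

section

variable {H : Type*} [NormedAddCommGroup H] [InnerProductSpace ℝ H]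

/-- The closed symmetric convex hull `B_1(D)` of a dictionary `D`: the closure of the set of all
finite sums `∑ a_j h_j` with `h_j ∈ D` and `∑ |a_j| ≤ 1`. -/
def unitHull (D : Set H) : Set H :=
  closure {x | ∃ (n : ℕ) (a : Fin n → ℝ) (h : Fin n → H),
    (∀ j, h j ∈ D) ∧ ∑ j, |a j| ≤ 1 ∧ x = ∑ j, a j • h j}

instance instHasOrthogonalProjectionSpanRange (g : ℕ → H) (n : ℕ) :
    (Submodule.span ℝ (Set.range fun i : Fin n => g i)).HasOrthogonalProjection := by
  have := FiniteDimensional.span_of_finite ℝ (Set.finite_range fun i : Fin n => g i)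
  infer_instance

/-- The orthogonal projection of `f` onto the span of the first `n` terms `g 0, …, g (n - 1)` of
the sequence `g`. It is `0` for `n = 0`. -/
def iterate (g : ℕ → H) (f : H) (n : ℕ) : H :=
  (Submodule.span ℝ (Set.range fun i : Fin n => g i)).starProjection f

/-- `g` is a sequence of dictionary elements that the orthogonal greedy algorithm may select for
the target `f`: with `f_k = iterate g f k`, the element selected in step `k + 1` is `g k`, and it
maximizes `|⟨d, f - f_k⟩|` over all `d ∈ D`. Ties may be broken in any way. -/
def IsGreedySelection (D : Set H) (f : H) (g : ℕ → H) : Prop :=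
  ∀ k, g k ∈ D ∧ IsMaxOn (fun d => |inner ℝ d (f - iterate g f k)|) D (g k)

end

/-- The dictionary `{k ^ (-α) e_k : k ≥ 1}` in the real space `ℓ²`, where `e_1, e_2, …` is the
standard orthonormal basis. Coordinates are numbered from `0` in the code, so `e_{k+1}` is
`lp.single 2 k 1`. -/
def powerDictionary (α : ℝ) : Set (lp (fun _ : ℕ => ℝ) 2) :=
  Set.range fun k : ℕ => ((k : ℝ) + 1) ^ (-α) • lp.single 2 k (1 : ℝ)

end GreedySharpness

end

namespace GreedySharpness

/-! ### Existence of greedy runs. -/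

section Selection

variable {H : Type*} [NormedAddCommGroup H] [InnerProductSpace ℝ H]

/-! Lower bound: let `f` be the average of the first `2n` atoms. Its first `2n` coordinates are at
least `(2n)^(-1-α)`, and any `n` atoms miss at least `n` of them, whatever the selection rule
(`exists_mem_unitHull_le_norm_sub_iterate`). Upper bound: the hull lies in `∑ k^α |x_k| ≤ 1`.
Rounding `x_k` towards zero to a multiple of `η k^α` costs at most `η k^α |x_k|` in squared error,
hence `√η` in norm (`exists_gridPoint_near`). The integer vectors used satisfy `∑ η k^(2α) |m_k| ≤
1`. With `η = N^(-1-2α)`, an exponential moment bound (`card_le_exp_mul_prod`) and a Riemann-sum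
estimate (`exists_sum_log_le`) show that there are at most `e^((1+C)N)` of them, so `N` proportional
to `n` gives `2^n` balls of radius `N^(-1/2-α)`. -/

lemma iterate_congr {g g' : ℕ → H} {n : ℕ} (h : ∀ i < n, g i = g' i) (f : H) :
    iterate g f n = iterate g' f n := by
  have : (fun i : Fin n => g i) = fun i : Fin n => g' i := funext fun i => h i i.2
  have hs : Submodule.span ℝ (Set.range fun i : Fin n => g i) =
      Submodule.span ℝ (Set.range fun i : Fin n => g' i) := by rw [this]
  unfold iterate
  congr 1
  congr 1

/-- The orthogonal greedy sequence for `f` driven by the selection rule `pick`. -/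
noncomputable def greedySequence (pick : H → H) (f : H) (k : ℕ) : H :=
  -- The value `0` for `i ≥ k` only makes the recursion well-founded: `iterate _ f k` reads indices
  -- below `k`.
  pick (f - iterate (fun i => if _h : i < k then greedySequence pick f i else 0) f k)

/-- If every residual admits a maximizer, the orthogonal greedy algorithm can be run. -/
lemma exists_isGreedySelection {D : Set H}
    (hD : ∀ r : H, ∃ d ∈ D, IsMaxOn (fun d => |inner ℝ d r|) D d) (f : H) :
    ∃ g : ℕ → H, IsGreedySelection D f g := by
  choose pick hmem hmax using hD
  refine ⟨greedySequence pick f, fun k => ?_⟩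
  have hk : greedySequence pick f k = pick (f - iterate (greedySequence pick f) f k) := by
    rw [greedySequence]
    congr 2
    exact iterate_congr (fun i hi => by simp [hi]) f
  rw [hk]
  exact ⟨hmem _, hmax _⟩

lemma sum_smul_mem_unitHull {D : Set H} {n : ℕ} {a : Fin n → ℝ} {h : Fin n → H}
    (hh : ∀ j, h j ∈ D) (ha : ∑ j, |a j| ≤ 1) : ∑ j, a j • h j ∈ unitHull D :=
  subset_closure ⟨n, a, h, hh, ha, rfl⟩

end Selection

/-! ### Atoms, coordinates and attained maxima in `ℓ²`. -/

/-- The real sequence space `ℓ²`. -/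
abbrev SeqSpace := lp (fun _ : ℕ => ℝ) 2

/-- The element `(k + 1) ^ (-α) e_{k + 1}` of the power dictionary. -/
noncomputable def atom (α : ℝ) (k : ℕ) : SeqSpace := ((k : ℝ) + 1) ^ (-α) • lp.single 2 k (1 : ℝ)

lemma atom_mem (α : ℝ) (k : ℕ) : atom α k ∈ powerDictionary α := ⟨k, rfl⟩

lemma atom_apply (α : ℝ) (k j : ℕ) :
    (atom α k : ℕ → ℝ) j = if j = k then ((k : ℝ) + 1) ^ (-α) else 0 := by
  simp [atom, lp.coeFn_smul, Pi.single_apply]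

lemma inner_atom (α : ℝ) (k : ℕ) (r : SeqSpace) :
    inner ℝ (atom α k) r = ((k : ℝ) + 1) ^ (-α) * r k := by
  rw [atom, inner_smul_left, lp.inner_single_left]
  simp

lemma norm_atom_le {α : ℝ} (hα : 0 < α) (k : ℕ) : ‖atom α k‖ ≤ 1 := by
  rw [atom, norm_smul, lp.norm_single (by norm_num), norm_one, mul_one, Real.norm_eq_abs,
    abs_of_nonneg (by positivity)]
  exact Real.rpow_le_one_of_one_le_of_nonpos (by simp) (by linarith)

lemma sum_sq_le_norm_sq (f : SeqSpace) (s : Finset ℕ) : ∑ i ∈ s, f i ^ 2 ≤ ‖f‖ ^ 2 := by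
  have := lp.sum_rpow_le_norm_rpow (p := 2) (by norm_num) f s
  simpa using this

lemma norm_le_of_forall_sum_sq_le {f : SeqSpace} {C : ℝ} (hC : 0 ≤ C)
    (h : ∀ s : Finset ℕ, ∑ i ∈ s, f i ^ 2 ≤ C ^ 2) : ‖f‖ ≤ C := by
  refine lp.norm_le_of_forall_sum_le (by norm_num) hC fun s => ?_
  simpa using h s

lemma tendsto_apply (f : SeqSpace) : Tendsto (fun k => f k) atTop (𝓝 0) := by
  have hs : Summable fun k => f k ^ 2 := by
    have := (lp.memℓp f).summable (by norm_num)
    simpa using this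
  have h := (hs.tendsto_atTop_zero).sqrt
  simp only [Real.sqrt_sq_eq_abs, Real.sqrt_zero] at h
  exact tendsto_zero_iff_abs_tendsto_zero _ |>.2 h

lemma exists_forall_le_of_tendsto_zero {u : ℕ → ℝ} (hu : ∀ k, 0 ≤ u k)
    (h : Tendsto u atTop (𝓝 0)) : ∃ k, ∀ j, u j ≤ u k := by
  by_cases h0 : ∀ j, u j = 0
  · exact ⟨0, fun j => by simp [h0]⟩
  push Not at h0
  obtain ⟨i, hi⟩ := h0
  have hi' : 0 < u i := lt_of_le_of_ne (hu i) (Ne.symm hi)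
  obtain ⟨n, hn⟩ := eventually_atTop.1 (h.eventually_lt_const hi')
  obtain ⟨k, -, hk⟩ := Finset.exists_max_image (Finset.range (n + i + 1)) u ⟨0, by simp⟩
  refine ⟨k, fun j => ?_⟩
  by_cases hj : j < n
  · exact hk j (by simp; omega)
  · exact (hn j (by omega)).le.trans (hk i (by rw [Finset.mem_range]; omega))

lemma exists_isMaxOn_powerDictionary {α : ℝ} (hα : 0 < α) (r : SeqSpace) :
    ∃ d ∈ powerDictionary α, IsMaxOn (fun d => |inner ℝ d r|) (powerDictionary α) d := by
  obtain ⟨k, hk⟩ := exists_forall_le_of_tendsto_zero (u := fun k => |inner ℝ (atom α k) r|)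
    (fun k => abs_nonneg _) <| by
      refine squeeze_zero (fun _ => abs_nonneg _) (fun k => ?_) (by simpa using (tendsto_apply r).abs)
      rw [inner_atom, abs_mul, abs_of_nonneg (by positivity)]
      exact mul_le_of_le_one_left (abs_nonneg _)
        (Real.rpow_le_one_of_one_le_of_nonpos (by simp) (by linarith))
  refine ⟨atom α k, atom_mem α k, ?_⟩
  rintro _ ⟨j, rfl⟩
  exact hk j

/-! ### The lower bound. -/

lemma iterate_apply_eq_zero {α : ℝ} {g : ℕ → SeqSpace} {κ : ℕ → ℕ} (hκ : ∀ i, g i = atom α (κ i))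
    (f : SeqSpace) (n : ℕ) {j : ℕ} (hj : ∀ i < n, κ i ≠ j) : iterate g f n j = 0 := by
  have hmem : iterate g f n ∈ Submodule.span ℝ (Set.range fun i : Fin n => g i) :=
    Submodule.starProjection_apply_mem _ _
  generalize iterate g f n = y at hmem
  induction hmem using Submodule.span_induction with
  | mem x hx =>
    obtain ⟨i, rfl⟩ := hx
    simp only [hκ, atom_apply]
    exact if_neg (hj i i.2).symm
  | zero => rfl
  | add x y _ _ hx hy => rw [lp.coeFn_add, Pi.add_apply, hx, hy, add_zero]
  | smul c x _ hx => rw [lp.coeFn_smul, Pi.smul_apply, hx, smul_zero]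

/-- The average of the first `2 n` dictionary elements is approximated badly by any selection. -/
lemma exists_mem_unitHull_le_norm_sub_iterate (α : ℝ) {n : ℕ} (hn : 1 ≤ n) (hα : 0 < α) :
    ∃ f ∈ unitHull (powerDictionary α), ∀ g : ℕ → SeqSpace,
      (∀ k, g k ∈ powerDictionary α) →
        2 ^ (-1 - α) * (n : ℝ) ^ (-(1 / 2 : ℝ) - α) ≤ ‖f - iterate g f n‖ := by
  have hn0 : (0 : ℝ) < n := by exact_mod_cast hn
  set f : SeqSpace := ∑ j : Fin (2 * n), (1 / (2 * n : ℝ)) • atom α j with hf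
  have hfm : f ∈ unitHull (powerDictionary α) := by
    refine sum_smul_mem_unitHull (fun j => atom_mem α j) (le_of_eq ?_)
    rw [Finset.sum_const, abs_of_pos (by positivity), Finset.card_univ, Fintype.card_fin]
    simp only [nsmul_eq_mul]
    push_cast
    field_simp
  have hfj : ∀ j < 2 * n, (2 * n : ℝ) ^ (-1 - α) ≤ f j := by
    intro j hj
    have : f j = 1 / (2 * n : ℝ) * ((j : ℝ) + 1) ^ (-α) := by
      rw [hf, lp.coeFn_sum, Finset.sum_apply]
      simp only [lp.coeFn_smul, Pi.smul_apply, atom_apply, smul_eq_mul]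
      rw [Finset.sum_eq_single ⟨j, hj⟩]
      · simp
      · intro b _ hb
        have : j ≠ b := fun h => hb (Fin.ext h.symm)
        simp [this]
      · simp
    rw [this, sub_eq_add_neg, Real.rpow_add (by positivity), Real.rpow_neg_one, one_div]
    refine mul_le_mul_of_nonneg_left ?_ (by positivity)
    refine Real.rpow_le_rpow_of_nonpos (by positivity) ?_ (by linarith)
    exact_mod_cast hj
  refine ⟨f, hfm, fun g hg => ?_⟩
  choose κ hκ using hg
  have hκ' : ∀ i, g i = atom α (κ i) := fun i => (hκ i).symm
  -- On the unselected coordinates the residual equals `f`.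
  set s := Finset.range (2 * n) \ (Finset.range n).image κ with hs
  have hcard : n ≤ s.card := by
    have h1 := Finset.le_card_sdiff ((Finset.range n).image κ) (Finset.range (2 * n))
    have h2 : ((Finset.range n).image κ).card ≤ n := by
      simpa using Finset.card_image_le (s := Finset.range n) (f := κ)
    rw [Finset.card_range, ← hs] at h1
    omega
  have hterm : ∀ j ∈ s, ((2 * n : ℝ) ^ (-1 - α)) ^ 2 ≤ (f - iterate g f n) j ^ 2 := by
    intro j hj
    rw [hs, Finset.mem_sdiff, Finset.mem_range, Finset.mem_image] at hj
    rw [lp.coeFn_sub, Pi.sub_apply, iterate_apply_eq_zero hκ' f n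
      (fun i hi h => hj.2 ⟨i, Finset.mem_range.2 hi, h⟩), sub_zero]
    exact pow_le_pow_left₀ (by positivity) (hfj j hj.1) 2
  have hsum : (n : ℝ) * ((2 * n : ℝ) ^ (-1 - α)) ^ 2 ≤ ‖f - iterate g f n‖ ^ 2 := by
    calc (n : ℝ) * ((2 * n : ℝ) ^ (-1 - α)) ^ 2
        ≤ s.card * ((2 * n : ℝ) ^ (-1 - α)) ^ 2 := by gcongr
      _ ≤ ∑ j ∈ s, (f - iterate g f n) j ^ 2 := by
        rw [← nsmul_eq_mul]
        exact Finset.card_nsmul_le_sum _ _ _ hterm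
      _ ≤ _ := sum_sq_le_norm_sq _ _
  refine le_of_sq_le_sq ?_ (norm_nonneg _)
  refine le_trans (le_of_eq ?_) hsum
  rw [Real.mul_rpow (by norm_num) hn0.le, mul_pow, mul_pow,
    show (-(1 / 2 : ℝ) - α) = 1 / 2 + (-1 - α) by ring, Real.rpow_add hn0, mul_pow,
    ← Real.sqrt_eq_rpow, Real.sq_sqrt hn0.le]
  ring

end GreedySharpness

namespace GreedySharpness

/-! ### Rounding and lattice point counting. -/

/-- Rounding towards zero to a multiple of `δ`. -/
lemma exists_int_round (x : ℝ) {δ : ℝ} (hδ : 0 < δ) :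
    ∃ m : ℤ, δ * |(m : ℝ)| ≤ |x| ∧ (x - δ * m) ^ 2 ≤ δ * |x| := by
  have key : ∀ y : ℝ, 0 ≤ y → ∃ m : ℤ, δ * |(m : ℝ)| ≤ y ∧ (y - δ * m) ^ 2 ≤ δ * y := by
    intro y hy
    refine ⟨⌊y / δ⌋, ?_⟩
    have h0 : (0 : ℝ) ≤ ⌊y / δ⌋ := by exact_mod_cast Int.floor_nonneg.2 (by positivity)
    have h1 : δ * ⌊y / δ⌋ ≤ y := by
      have := (le_div_iff₀ hδ).1 (Int.floor_le (y / δ)); linarith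
    have h2 : y - δ * ⌊y / δ⌋ ≤ δ := by
      have := (div_lt_iff₀ hδ).1 (Int.lt_floor_add_one (y / δ)); linarith
    refine ⟨by rwa [abs_of_nonneg h0], ?_⟩
    -- The error is at most `δ` and at most `y`; one factor of the square is bounded by each.
    rw [sq]
    exact mul_le_mul h2 (by nlinarith) (by linarith) hδ.le
  rcases le_total 0 x with hx | hx
  · simpa [abs_of_nonneg hx] using key x hx
  · obtain ⟨m, h1, h2⟩ := key (-x) (by linarith)
    refine ⟨-m, by simpa [abs_of_nonpos hx] using h1, ?_⟩
    rw [abs_of_nonpos hx]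
    push_cast
    linarith [h2, show (x - δ * -(m : ℝ)) ^ 2 = (-x - δ * m) ^ 2 by ring]

lemma sum_exp_neg_mul_abs_le {w : ℝ} (hw : 0 < w) (T : Finset ℤ) :
    ∑ j ∈ T, Real.exp (-(w * |(j : ℝ)|)) ≤ 1 + 2 / (Real.exp w - 1) := by
  set q := Real.exp (-w) with hq
  have hq0 : 0 < q := Real.exp_pos _
  have hq1 : q < 1 := by rw [hq, Real.exp_lt_one_iff]; linarith
  have hpow : ∀ n : ℕ, q ^ n = Real.exp (-(w * n)) := fun n => by
    rw [hq, ← Real.exp_nat_mul]; congr 1; ring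
  have hgeo := hasSum_geometric_of_lt_one hq0.le hq1
  have hs : HasSum (fun j : ℤ => Real.exp (-(w * |(j : ℝ)|))) ((1 - q)⁻¹ + q * (1 - q)⁻¹) := by
    refine HasSum.of_nat_of_neg_add_one ?_ ?_
    · convert! hgeo using 2 with n
      simp [hpow]
    · convert! hgeo.mul_left q using 2 with n
      rw [← pow_succ', hpow]
      push_cast
      rw [abs_neg, abs_of_nonneg (by positivity)]
  refine (sum_le_hasSum T (fun _ _ => (Real.exp_pos _).le) hs).trans (le_of_eq ?_)
  have h1 : Real.exp w = q⁻¹ := by rw [hq, Real.exp_neg, inv_inv]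
  have h2 : 1 - q ≠ 0 := by linarith
  rw [h1]
  have h3 : q⁻¹ - 1 = (1 - q) / q := by field_simp
  rw [h3]
  field_simp
  ring

/-- Exponential-moment bound for the number of integer points of a weighted `ℓ¹` ball. -/
lemma card_le_exp_mul_prod {L : ℕ} {w : Fin L → ℝ} (hw : ∀ k, 0 < w k) {R : ℝ}
    (S : Finset (Fin L → ℤ)) (hS : ∀ m ∈ S, ∑ k, w k * |(m k : ℝ)| ≤ R) :
    (S.card : ℝ) ≤ Real.exp R * ∏ k, (1 + 2 / (Real.exp (w k) - 1)) := by
  classical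
  set T : Fin L → Finset ℤ := fun k => S.image fun m => m k
  have hST : S ⊆ Fintype.piFinset T := fun m hm =>
    Fintype.mem_piFinset.2 fun k => Finset.mem_image_of_mem _ hm
  calc (S.card : ℝ) = ∑ _m ∈ S, (1 : ℝ) := by simp
    -- Each point of `S` has weight at least `1`; over the enclosing box the weights factor into
    -- one-dimensional sums.
    _ ≤ ∑ m ∈ S, Real.exp R * ∏ k, Real.exp (-(w k * |(m k : ℝ)|)) := by
      refine Finset.sum_le_sum fun m hm => ?_
      rw [← Real.exp_sum, ← Real.exp_add, Finset.sum_neg_distrib]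
      exact Real.one_le_exp (by linarith [hS m hm])
    _ ≤ ∑ m ∈ Fintype.piFinset T, Real.exp R * ∏ k, Real.exp (-(w k * |(m k : ℝ)|)) :=
      Finset.sum_le_sum_of_subset_of_nonneg hST fun _ _ _ => by positivity
    _ = Real.exp R * ∏ k, ∑ j ∈ T k, Real.exp (-(w k * |(j : ℝ)|)) := by
      rw [← Finset.mul_sum, Finset.prod_univ_sum]
    _ ≤ _ := by
      gcongr with k
      exact sum_exp_neg_mul_abs_le (hw k) _

/-- The majorant is the derivative of `√s / (1 + √s)` at `s = t ^ 2`, so its Riemann sums telescope.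
It dominates a logarithmic singularity at `0` and decays only like `t^(-3)`. -/
lemma exists_log_le {β : ℝ} (hβ : 0 < β) :
    ∃ C : ℝ, 0 < C ∧ ∀ t : ℝ, 0 < t →
      Real.log (1 + 2 / (Real.exp (t ^ β) - 1)) ≤ C * (1 / (2 * t * (1 + t) ^ 2)) := by
  obtain ⟨j, hj⟩ := exists_nat_ge (3 / β)
  have hj3 : 3 ≤ β * j := by rw [div_le_iff₀ hβ] at hj; linarith
  have hj1 : 1 ≤ j := by
    rcases Nat.eq_zero_or_pos j with h | h
    · subst h; norm_num at hj3
    · exact h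
  refine ⟨max (8 * (2 + β)) (16 * j.factorial), by positivity, fun t ht => ?_⟩
  have hs : 0 < t ^ β := Real.rpow_pos_of_pos ht _
  rw [mul_one_div, le_div_iff₀ (by positivity)]
  rcases le_total t 1 with h1 | h1
  · refine le_trans ?_ (le_max_left _ _)
    have hs1 : t ^ β ≤ 1 := Real.rpow_le_one ht.le h1 hβ.le
    have hlog : Real.log (1 + 2 / (Real.exp (t ^ β) - 1)) ≤ 2 + β * (1 / t) := by
      have hle : 1 + 2 / (Real.exp (t ^ β) - 1) ≤ 3 / t ^ β := by
        have : 2 / (Real.exp (t ^ β) - 1) ≤ 2 / t ^ β :=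
          div_le_div_of_nonneg_left (by norm_num) hs (by linarith [Real.add_one_le_exp (t ^ β)])
        have h' : 1 ≤ 1 / t ^ β := (one_le_div hs).2 hs1
        calc _ ≤ 1 / t ^ β + 2 / t ^ β := by linarith
          _ = _ := by ring
      have hpos : 0 < 1 + 2 / (Real.exp (t ^ β) - 1) := by
        have : 0 < Real.exp (t ^ β) - 1 := by linarith [Real.add_one_le_exp (t ^ β)]
        positivity
      refine (Real.log_le_log hpos hle).trans ?_
      rw [Real.log_div (by norm_num) hs.ne', Real.log_rpow ht]
      have h3 : Real.log 3 ≤ 2 := (Real.log_le_sub_one_of_pos (by norm_num)).trans (by norm_num)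
      have h4 : -Real.log t ≤ 1 / t := by
        rw [← Real.log_inv, one_div]
        linarith [Real.log_le_sub_one_of_pos (inv_pos.2 ht)]
      nlinarith
    calc _ ≤ (2 + β * (1 / t)) * (2 * t * (1 + t) ^ 2) := by gcongr
      _ = (2 * t + β) * (2 * (1 + t) ^ 2) := by field_simp
      _ ≤ (2 * 1 + β) * (2 * (1 + 1) ^ 2) := by gcongr
      _ = _ := by ring
  · refine le_trans ?_ (le_max_right _ _)
    have hfac : (0 : ℝ) < j.factorial := by exact_mod_cast j.factorial_pos
    -- Since `β * j ≥ 3`, the `j`-th term of the exponential series already gives cubic growth.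
    have hexp : t ^ 3 / j.factorial ≤ Real.exp (t ^ β) - 1 := by
      have h2 : ∑ i ∈ ({0, j} : Finset ℕ), (t ^ β) ^ i / (i.factorial : ℝ) ≤ Real.exp (t ^ β) := by
        refine le_trans ?_ (Real.sum_le_exp_of_nonneg hs.le (j + 1))
        refine Finset.sum_le_sum_of_subset_of_nonneg ?_ fun _ _ _ => by positivity
        intro i hi
        simp only [Finset.mem_insert, Finset.mem_singleton] at hi
        simp only [Finset.mem_range]
        omega
      rw [Finset.sum_pair (by omega)] at h2
      have h3 : t ^ 3 ≤ (t ^ β) ^ j := by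
        rw [← Real.rpow_mul_natCast ht.le, ← Real.rpow_natCast t 3]
        exact Real.rpow_le_rpow_of_exponent_le h1 (by exact_mod_cast hj3)
      have h4 : t ^ 3 / j.factorial ≤ (t ^ β) ^ j / j.factorial := by gcongr
      simp at h2
      linarith
    have hpos : 0 < t ^ 3 / j.factorial := by positivity
    have hlog : Real.log (1 + 2 / (Real.exp (t ^ β) - 1)) ≤ 2 / (t ^ 3 / j.factorial) := by
      have hd : 0 < Real.exp (t ^ β) - 1 := hpos.trans_le hexp
      have := Real.log_le_sub_one_of_pos (x := 1 + 2 / (Real.exp (t ^ β) - 1)) (by positivity)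
      have h' := div_le_div_of_nonneg_left (by norm_num : (0 : ℝ) ≤ 2) hpos hexp
      linarith
    calc _ ≤ 2 / (t ^ 3 / j.factorial) * (2 * t * (t + t) ^ 2) := by gcongr
      _ = _ := by field_simp; ring

/-- For the concave function `√s / (1 + √s)`, the slope at the right endpoint of `[k/N, (k+1)/N]` is
at most the difference quotient. -/
lemma one_div_le_sub_of_sqrt {N : ℝ} (hN : 0 < N) (k : ℕ) :
    1 / (2 * (√(k + 1) / √N) * (1 + √(k + 1) / √N) ^ 2) ≤
      N * (√((k + 1 : ℕ) : ℝ) / (√N + √((k + 1 : ℕ) : ℝ)) - √(k : ℝ) / (√N + √(k : ℝ))) := by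
  push_cast
  have hN' : N = √N ^ 2 := (Real.sq_sqrt hN.le).symm
  have hM : 0 < √N := Real.sqrt_pos.2 hN
  have hb : 0 < √((k : ℝ) + 1) := Real.sqrt_pos.2 (by positivity)
  have ha : 0 ≤ √(k : ℝ) := Real.sqrt_nonneg _
  have hab : √(k : ℝ) ≤ √((k : ℝ) + 1) := Real.sqrt_le_sqrt (by linarith)
  have hd : (√((k : ℝ) + 1) - √k) * (√((k : ℝ) + 1) + √k) = 1 := by
    have h1 := Real.sq_sqrt (show (0 : ℝ) ≤ k by positivity)
    have h2 := Real.sq_sqrt (show (0 : ℝ) ≤ (k : ℝ) + 1 by positivity)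
    nlinarith
  generalize √N = M at *
  generalize √((k : ℝ) + 1) = b at *
  generalize √(k : ℝ) = a at *
  have hc : b - a = 1 / (b + a) := by
    rw [eq_div_iff (by positivity)]; exact hd
  have e1 : 1 / (2 * (b / M) * (1 + b / M) ^ 2) = M ^ 3 / ((2 * b * (M + b)) * (M + b)) := by
    field_simp
  have e2 : N * (b / (M + b) - a / (M + a)) = M ^ 3 / (((b + a) * (M + a)) * (M + b)) := by
    have : b / (M + b) - a / (M + a) = M * (b - a) / ((M + a) * (M + b)) := by
      field_simp; ring
    rw [this, hc, hN']
    field_simp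
  rw [e1, e2]
  gcongr
  linarith

/-- Put `t = √((k+1)/N)` and `β = 4α`; the telescoped sum is below `1`, uniformly in `L`. -/
lemma exists_sum_log_le {α : ℝ} (hα : 0 < α) :
    ∃ C : ℝ, 0 < C ∧ ∀ N : ℝ, 0 < N → ∀ L : ℕ,
      ∑ k ∈ Finset.range L,
        Real.log (1 + 2 / (Real.exp ((((k : ℝ) + 1) / N) ^ (2 * α)) - 1)) ≤ C * N := by
  obtain ⟨C, hC, h⟩ := exists_log_le (β := 4 * α) (by positivity)
  refine ⟨C, hC, fun N hN L => ?_⟩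
  have hM : 0 < √N := Real.sqrt_pos.2 hN
  set G : ℕ → ℝ := fun k => √(k : ℝ) / (√N + √(k : ℝ)) with hG
  calc _ ≤ ∑ k ∈ Finset.range L, C * (N * (G (k + 1) - G k)) := by
        refine Finset.sum_le_sum fun k _ => ?_
        have ht : 0 < √((k : ℝ) + 1) / √N := by positivity
        have e : (√((k : ℝ) + 1) / √N) ^ (4 * α) = (((k : ℝ) + 1) / N) ^ (2 * α) := by
          rw [← Real.sqrt_div (by positivity), Real.sqrt_eq_rpow, ← Real.rpow_mul (by positivity)]
          congr 1; ring
        have h1 := h _ ht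
        rw [e] at h1
        exact h1.trans (mul_le_mul_of_nonneg_left (one_div_le_sub_of_sqrt hN k) hC.le)
    _ = C * (N * (G L - G 0)) := by
        rw [← Finset.mul_sum, ← Finset.mul_sum, Finset.sum_range_sub]
    _ ≤ C * (N * 1) := by
        gcongr
        have h0 : G 0 = 0 := by simp [hG]
        have h1 : G L ≤ 1 := by
          rw [hG]
          exact (div_le_one (by positivity)).2 (by linarith)
        linarith
    _ = C * N := by ring

/-! ### The net and the entropy bound. -/

/-- Elements of the hull lie in the weighted `ℓ¹` ball. -/
lemma sum_rpow_mul_abs_le_one {α : ℝ} {x : SeqSpace}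
    (hx : x ∈ unitHull (powerDictionary α)) (s : Finset ℕ) :
    ∑ k ∈ s, ((k : ℝ) + 1) ^ α * |x k| ≤ 1 := by
  have hcont : ∀ k, Continuous fun y : SeqSpace => y k := fun k =>
    LipschitzWith.continuous (K := 1) <| LipschitzWith.of_dist_le_mul fun y z => by
      rw [dist_eq_norm, dist_eq_norm, NNReal.coe_one, one_mul]
      exact lp.norm_apply_le_norm (by norm_num) (y - z) k
  have hclosed : IsClosed {y : SeqSpace | ∑ k ∈ s, ((k : ℝ) + 1) ^ α * |y k| ≤ 1} :=
    isClosed_le (continuous_finsetSum _ fun k _ => continuous_const.mul (hcont k).abs)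
      continuous_const
  refine closure_minimal ?_ hclosed hx
  rintro _ ⟨n, a, h, hh, ha, rfl⟩
  choose κ hκ using hh
  have hap : ∀ k, (∑ j, a j • h j : SeqSpace) k =
      ∑ j, a j * (if k = κ j then ((κ j : ℝ) + 1) ^ (-α) else 0) := by
    intro k
    rw [lp.coeFn_sum, Finset.sum_apply]
    refine Finset.sum_congr rfl fun j _ => ?_
    rw [lp.coeFn_smul, Pi.smul_apply, smul_eq_mul, ← hκ j]
    exact congrArg _ (atom_apply α (κ j) k)
  calc ∑ k ∈ s, ((k : ℝ) + 1) ^ α * |(∑ j, a j • h j : SeqSpace) k|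
      ≤ ∑ k ∈ s, ∑ j, if k = κ j then |a j| else 0 := by
        refine Finset.sum_le_sum fun k _ => ?_
        rw [hap]
        refine (mul_le_mul_of_nonneg_left (Finset.abs_sum_le_sum_abs _ _)
          (by positivity)).trans (le_of_eq ?_)
        rw [Finset.mul_sum]
        refine Finset.sum_congr rfl fun j _ => ?_
        split_ifs with hk
        · rw [← hk, abs_mul, abs_of_nonneg (a := ((k : ℝ) + 1) ^ (-α)) (by positivity),
            Real.rpow_neg (by positivity)]
          have : ((k : ℝ) + 1) ^ α ≠ 0 := by positivity
          field_simp
        · simp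
    _ = ∑ j, ∑ k ∈ s, if k = κ j then |a j| else 0 := Finset.sum_comm
    _ ≤ ∑ j, |a j| := by
        refine Finset.sum_le_sum fun j _ => ?_
        rw [Finset.sum_ite_eq']
        split_ifs
        · exact le_rfl
        · exact abs_nonneg _
    _ ≤ 1 := ha

/-- The sequence with the finitely many coordinates `(k + 1) ^ α * η * m k`. -/
noncomputable def gridPoint (α η : ℝ) {L : ℕ} (m : Fin L → ℤ) : SeqSpace :=
  ∑ k : Fin L, lp.single 2 (k : ℕ) (((k : ℝ) + 1) ^ α * η * m k)

lemma gridPoint_apply (α η : ℝ) {L : ℕ} (m : ℕ → ℤ) (k : ℕ) :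
    gridPoint α η (fun i : Fin L => m i) k =
      if k < L then ((k : ℝ) + 1) ^ α * η * m k else 0 := by
  rw [gridPoint, Fin.sum_univ_eq_sum_range
    (fun i : ℕ => (lp.single 2 i (((i : ℝ) + 1) ^ α * η * m i) : SeqSpace)), lp.coeFn_sum,
    Finset.sum_apply]
  simp only [lp.coeFn_single, Pi.single_apply, Finset.sum_ite_eq, Finset.mem_range]

/-- The rounding net: every element of the hull is close to a grid point whose integer
coordinates satisfy a weighted `ℓ¹` bound. -/
lemma exists_gridPoint_near {α η : ℝ} (hη : 0 < η) {L : ℕ}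
    (hL : 1 < η * ((L : ℝ) + 1) ^ (2 * α)) (hα : 0 < α) {x : SeqSpace}
    (hx : x ∈ unitHull (powerDictionary α)) :
    ∃ m : Fin L → ℤ, ∑ k : Fin L, η * ((k : ℝ) + 1) ^ (2 * α) * |(m k : ℝ)| ≤ 1 ∧
      ‖x - gridPoint α η m‖ ≤ √η := by
  have hδ : ∀ k : ℕ, 0 < ((k : ℝ) + 1) ^ α * η := fun k => by positivity
  choose m hm1 hm2 using fun k : ℕ => exists_int_round (x k) (hδ k)
  have hsq : ∀ k : ℕ, ((k : ℝ) + 1) ^ (2 * α) = ((k : ℝ) + 1) ^ α * ((k : ℝ) + 1) ^ α := by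
    intro k; rw [← Real.rpow_add (by positivity)]; congr 1; ring
  have hw : ∀ k : ℕ, η * ((k : ℝ) + 1) ^ (2 * α) * |(m k : ℝ)| ≤ ((k : ℝ) + 1) ^ α * |x k| := by
    intro k
    have := mul_le_mul_of_nonneg_left (hm1 k) (show 0 ≤ ((k : ℝ) + 1) ^ α by positivity)
    rw [hsq]; linarith
  -- By `hL`, a nonzero `m k` with `k ≥ L` would alone exceed the weighted bound `1`, so cutting off
  -- at `L` costs nothing.
  have hzero : ∀ k, L ≤ k → m k = 0 := by
    intro k hk
    by_contra hne
    have h1 : (1 : ℝ) ≤ |(m k : ℝ)| := by exact_mod_cast Int.one_le_abs hne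
    have h2 := sum_rpow_mul_abs_le_one hx {k}
    rw [Finset.sum_singleton] at h2
    have h3 : ((L : ℝ) + 1) ^ (2 * α) ≤ ((k : ℝ) + 1) ^ (2 * α) := by
      gcongr
    have h4 := mul_le_mul_of_nonneg_left h3 hη.le
    have h5 := le_mul_of_one_le_right
      (show 0 ≤ η * ((k : ℝ) + 1) ^ (2 * α) by positivity) h1
    linarith [hw k]
  refine ⟨fun i => m i, ?_, ?_⟩
  · rw [Fin.sum_univ_eq_sum_range (fun i : ℕ => η * ((i : ℝ) + 1) ^ (2 * α) * |(m i : ℝ)|)]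
    exact (Finset.sum_le_sum fun k _ => hw k).trans (sum_rpow_mul_abs_le_one hx _)
  · refine norm_le_of_forall_sum_sq_le (Real.sqrt_nonneg _) fun s => ?_
    rw [Real.sq_sqrt hη.le]
    calc ∑ k ∈ s, (x - gridPoint α η fun i : Fin L => m i) k ^ 2
        ≤ ∑ k ∈ s, η * (((k : ℝ) + 1) ^ α * |x k|) := by
          refine Finset.sum_le_sum fun k _ => ?_
          rw [lp.coeFn_sub, Pi.sub_apply, gridPoint_apply]
          have : (if k < L then ((k : ℝ) + 1) ^ α * η * m k else 0) =
              ((k : ℝ) + 1) ^ α * η * m k := by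
            split_ifs with hk
            · rfl
            · simp [hzero k (not_lt.1 hk)]
          rw [this]
          linarith [hm2 k]
      _ ≤ η * 1 := by
          rw [← Finset.mul_sum]
          exact mul_le_mul_of_nonneg_left (sum_rpow_mul_abs_le_one hx s) hη.le
      _ = η := mul_one η

lemma encard_le_of_forall_finset_card_le {X : Type*} {A : Set X} {c : ℕ}
    (h : ∀ S : Finset X, (S : Set X) ⊆ A → S.card ≤ c) : A.encard ≤ c := by
  have hfin : A.Finite := by
    by_contra hinf
    obtain ⟨S, hS, hc⟩ := Set.Infinite.exists_subset_card_eq hinf (c + 1)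
    have := h S hS
    omega
  rw [hfin.encard_eq_coe_toFinset_card]
  exact_mod_cast h hfin.toFinset (by simp)

lemma metricEntropy_unitHull_le {α : ℝ} (hα : 0 < α) :
    ∃ C : ℝ, 0 < C ∧ ∀ n : ℕ, 1 ≤ n →
      metricEntropy n (unitHull (powerDictionary α)) ≤
        ENNReal.ofReal (C * (n : ℝ) ^ (-(1 / 2 : ℝ) - α)) := by
  obtain ⟨C, hC, hlog⟩ := exists_sum_log_le hα
  -- Chosen so that `(1 + C) * N = n * log 2` for `N = c * n`.
  set c := Real.log 2 / (1 + C) with hc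
  have hc0 : 0 < c := div_pos (Real.log_pos (by norm_num)) (by positivity)
  refine ⟨c ^ (-(1 / 2 : ℝ) - α), by positivity, fun n hn => ?_⟩
  have hn0 : (0 : ℝ) < n := by exact_mod_cast hn
  set N := c * n with hN
  have hN0 : 0 < N := by positivity
  -- Scaling the constraint by `N` then turns its weights into `((k+1)/N)^(2α)`, with right side
  -- `N`.
  set η := N ^ (-1 - 2 * α) with hη
  have hη0 : 0 < η := by positivity
  have hηN : ∀ y : ℝ, 0 ≤ y → N * (η * y ^ (2 * α)) = (y / N) ^ (2 * α) := by
    intro y hy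
    rw [Real.div_rpow hy hN0.le, hη, sub_eq_add_neg, Real.rpow_add hN0, Real.rpow_neg_one,
      Real.rpow_neg hN0.le]
    field_simp
  obtain ⟨L, hL⟩ : ∃ L : ℕ, 1 < η * ((L : ℝ) + 1) ^ (2 * α) := by
    have : Tendsto (fun L : ℕ => η * ((L : ℝ) + 1) ^ (2 * α)) atTop atTop :=
      ((tendsto_rpow_atTop (by positivity)).comp
        (tendsto_atTop_add_const_right _ (1 : ℝ) tendsto_natCast_atTop_atTop)).const_mul_atTop hη0
    exact (this.eventually_gt_atTop 1).exists
  set A : Set (Fin L → ℤ) := {m | ∑ k : Fin L, η * ((k : ℝ) + 1) ^ (2 * α) * |(m k : ℝ)| ≤ 1}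
  have hcover : Metric.IsCover (Real.sqrt η).toNNReal (unitHull (powerDictionary α))
      (gridPoint α η '' A) := by
    intro x hx
    obtain ⟨m, hm, hd⟩ := exists_gridPoint_near hη0 hL hα hx
    refine ⟨_, ⟨m, hm, rfl⟩, ?_⟩
    change edist x (gridPoint α η m) ≤ _
    rw [edist_dist, dist_eq_norm]
    exact ENNReal.ofReal_le_ofReal hd
  have hcard : A.encard ≤ (2 ^ n : ℕ) := by
    refine encard_le_of_forall_finset_card_le fun S hS => ?_
    have h1 := card_le_exp_mul_prod (R := N)
      (w := fun k : Fin L => (((k : ℝ) + 1) / N) ^ (2 * α)) (fun k => by positivity) S <| by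
        intro m hm
        have := mul_le_mul_of_nonneg_left (hS hm) hN0.le
        rw [Finset.mul_sum, mul_one] at this
        refine (le_of_eq (Finset.sum_congr rfl fun k _ => ?_)).trans this
        rw [← hηN _ (by positivity)]
        ring
    have hpos : ∀ k : ℕ, 0 < 1 + 2 / (Real.exp ((((k : ℝ) + 1) / N) ^ (2 * α)) - 1) := by
      intro k
      have : 0 < (((k : ℝ) + 1) / N) ^ (2 * α) := by positivity
      have : 0 < Real.exp ((((k : ℝ) + 1) / N) ^ (2 * α)) - 1 := by
        linarith [Real.add_one_le_exp ((((k : ℝ) + 1) / N) ^ (2 * α))]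
      positivity
    have h2 : ∏ k : Fin L, (1 + 2 / (Real.exp ((((k : ℝ) + 1) / N) ^ (2 * α)) - 1)) ≤
        Real.exp (C * N) := by
      rw [Fin.prod_univ_eq_prod_range
        (fun k : ℕ => 1 + 2 / (Real.exp ((((k : ℝ) + 1) / N) ^ (2 * α)) - 1)),
        ← Finset.prod_congr rfl fun k _ => Real.exp_log (hpos k), ← Real.exp_sum]
      exact Real.exp_le_exp.2 (hlog N hN0 L)
    have h3 : (S.card : ℝ) ≤ ((2 ^ n : ℕ) : ℝ) := by
      refine h1.trans ((mul_le_mul_of_nonneg_left h2 (Real.exp_pos _).le).trans (le_of_eq ?_))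
      have e : N + C * N = n * Real.log 2 := by
        rw [hN, hc]; field_simp
      rw [← Real.exp_add, e, Real.exp_nat_mul, Real.exp_log (by norm_num)]
      norm_cast
    exact_mod_cast h3
  have hcov : Metric.externalCoveringNumber (Real.sqrt η).toNNReal
      (unitHull (powerDictionary α)) ≤ 2 ^ n := by
    refine hcover.externalCoveringNumber_le_encard.trans ((Set.encard_image_le _ _).trans ?_)
    exact_mod_cast hcard
  have hent : metricEntropy n (unitHull (powerDictionary α)) ≤ ((√η).toNNReal : ℝ≥0∞) :=
    iInf₂_le (√η).toNNReal hcov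
  refine hent.trans (le_of_eq ?_)
  change ENNReal.ofReal (√η) = _
  rw [← Real.mul_rpow hc0.le hn0.le, ← hN, hη, Real.sqrt_eq_rpow, ← Real.rpow_mul hN0.le]
  congr 2
  ring

end GreedySharpness

theorem mainTheorem5 (α : ℝ) (hα : 0 < α) :
    -- the dictionary is normalized: all its elements have norm at most one
    (∀ d ∈ GreedySharpness.powerDictionary α, ‖d‖ ≤ 1) ∧
    -- entropy bound for the closed convex hull
    (∃ C : ℝ, 0 < C ∧ ∀ n : ℕ, 1 ≤ n →
      GreedySharpness.metricEntropy n
          (GreedySharpness.unitHull (GreedySharpness.powerDictionary α)) ≤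
        ENNReal.ofReal (C * (n : ℝ) ^ (-(1 / 2 : ℝ) - α))) ∧
    -- the orthogonal greedy algorithm can be run on every target
    (∀ f : lp (fun _ : ℕ => ℝ) 2, ∃ g : ℕ → lp (fun _ : ℕ => ℝ) 2,
      GreedySharpness.IsGreedySelection (GreedySharpness.powerDictionary α) f g) ∧
    -- lower bound for the worst-case error, however ties are broken for each target
    (∃ K : ℝ, 0 < K ∧
      ∀ g : lp (fun _ : ℕ => ℝ) 2 → ℕ → lp (fun _ : ℕ => ℝ) 2,
        (∀ f ∈ GreedySharpness.unitHull (GreedySharpness.powerDictionary α),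
          GreedySharpness.IsGreedySelection (GreedySharpness.powerDictionary α) f (g f)) →
        ∀ n : ℕ, 1 ≤ n →
          ENNReal.ofReal (K * (n : ℝ) ^ (-(1 / 2 : ℝ) - α)) ≤
            ⨆ f ∈ GreedySharpness.unitHull (GreedySharpness.powerDictionary α),
              ‖f - GreedySharpness.iterate (g f) f n‖ₑ) ∧
    -- hence no uniform error bound of smaller order holds
    (¬ ∃ ρ : ℕ → ℝ,
      ρ =o[atTop] (fun n : ℕ => (n : ℝ) ^ (-(1 / 2 : ℝ) - α)) ∧
      ∀ᶠ n in atTop,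
        ∀ f ∈ GreedySharpness.unitHull (GreedySharpness.powerDictionary α),
          ∀ g : ℕ → lp (fun _ : ℕ => ℝ) 2,
            GreedySharpness.IsGreedySelection (GreedySharpness.powerDictionary α) f g →
              ‖f - GreedySharpness.iterate g f n‖ ≤ ρ n) := by
  have hrun := fun f => GreedySharpness.exists_isGreedySelection
    (GreedySharpness.exists_isMaxOn_powerDictionary hα) f
  refine ⟨?_, GreedySharpness.metricEntropy_unitHull_le hα, hrun, ?_, ?_⟩
  · rintro _ ⟨k, rfl⟩
    exact GreedySharpness.norm_atom_le hα k
  · refine ⟨2 ^ (-1 - α), by positivity, fun g hg n hn => ?_⟩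
    obtain ⟨f, hf, h⟩ := GreedySharpness.exists_mem_unitHull_le_norm_sub_iterate α hn hα
    refine le_iSup₂_of_le f hf ?_
    rw [← ofReal_norm]
    exact ENNReal.ofReal_le_ofReal (h (g f) fun k => (hg f hf k).1)
  · rintro ⟨ρ, hρ, hev⟩
    -- Half the lower-bound constant, so that the two bounds conflict strictly.
    have hK : (0 : ℝ) < 2 ^ (-1 - α) / 2 := by positivity
    obtain ⟨n, ⟨hn, hle⟩, hn1⟩ :=
      ((hρ.def hK).and hev |>.and (eventually_ge_atTop 1)).exists
    obtain ⟨f, hf, h⟩ := GreedySharpness.exists_mem_unitHull_le_norm_sub_iterate α hn1 hα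
    obtain ⟨g, hg⟩ := hrun f
    have h1 := h g fun k => (hg k).1
    have h2 := hle f hf g hg
    have hn0 : (0 : ℝ) < n := by exact_mod_cast hn1
    have hp : 0 < (n : ℝ) ^ (-(1 / 2 : ℝ) - α) := by positivity
    rw [Real.norm_of_nonneg hp.le] at hn
    have h3 := (le_abs_self _).trans hn
    have : 0 < (2 : ℝ) ^ (-1 - α) * (n : ℝ) ^ (-(1 / 2 : ℝ) - α) := by positivity
    linarith
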